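/- Consider the p-system $v_t-u_x=0$, $u_t+p(v)_x=0$ with $p(v)=\frac1{3v^3}$, density $\rho=1/v$, and Riemann invariants $w_1=\rho-u$, $w_2=\rho+u$. Let $0<\alpha/3<\beta<\alpha<1$ and let $\kappa<3^{-2/3}$. Then there is $\delta_0>0$, depending only on $\alpha,\beta,\kappa$, such that the following holds for all $\delta\in\,]0,\delta_0[$, all $c>0$ and all $\xi\ge\delta$. Take initial data $(\rho,u)(0,\cdot)$ with $w_1(0,x)=0$ for all $x<\xi$ and $$w_2(0,x)=\begin{cases}0& x\le 0\\ x^\alpha\,(2+\sin x^{-\beta})& 0<x\le \delta\\ \delta^\alpha\,(2+\sin\delta^{-\beta})&\delta\le x<\xi\end{cases}$$ (so that $\rho=0$ for $x\le0$), with an admissible 1-shock at $x=\xi$ of unit strength, i.e. $|w_1(0,\xi+)-w_1(0,\xi-)|=1$, and with a constant state for $x>\xi$. Put $T=\xi/2c$ (so $T=\delta/2c$ if the shock starts at $\xi=\delta$). On $[0,T[$ consider approximate solutions $(\rho,u)$ with $\rho\ge0$ and these initial data, in which the 1-shock is located at $x=\xi-ct$, 1-waves travel with constant speed $-c$ and 2-waves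 with constant speed $c$ (on either side of the shock, $w_1$ is constant along lines $\dot x=-c$ and $w_2$ along lines $\dot x=c$), while outgoing strengths are exact: $(\rho,u)$ has limits $(\rho_\mp,u_\mp)(t)$ at $(t,\xi-ct)$ from the space-time regions $x<\xi-ct$ and $x>\xi-ct$, and these two states are joined by an admissible 1-shock of the p-system (the Rankine-Hugoniot equations and the Lax condition for the characteristic speed $-\rho^2$ hold for some shock speed, not necessarily $-c$). Such approximate solutions exist, and every one of them has the following properties. 1. For $0\le t<T$ one has $w_1(t,x)=0$ if $x<\xi-ct$, and $w_1(t,x)=1$ if $x>\xi-ct$; so the 1-shock keeps unit strength. 2. Each 2-wave that crosses the shock is amplified by a factor at least $\kappa\rho_-^{-2/3}$, where $\rho_-$ is the density ahead of the shock. Namely, for $0\le t<T$ and $y,z\in\,]\xi-2ct,\xi[$, $$|w_2(t,y+ct)-w_2(t,z+ct)|\ \ge\ \kappa\,\max\{\rho(0,y),\rho(0,z)\}^{-2/3}\,|w_2(0,y)-w_2(0,z)|,$$ and for $0\le t<T$ and $\xi-2ct<y<\delta$ the function $w_2(t,\cdot)$ is differentiable at $y+ct$, with $$|w_{2,x}(t,y+ct)|\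 \ge\ \kappa\,\rho(0,y)^{-2/3}\,\big|\alpha y^{\alpha-1}(2+\sin y^{-\beta})-\beta y^{\alpha-\beta-1}\cos y^{-\beta}\big|.$$ 3. The total variation $\mathrm{Tot.Var.}\{w_1(t,\cdot);\mathbb R\}+\mathrm{Tot.Var.}\{w_2(t,\cdot);\mathbb R\}$ is finite at $t=0$ and for every $t\in[0,T[$, and tends to $+\infty$ as $t\to T-$. -/

import Mathlib

open Set Filter Topology

namespace PSystem

/-- Pressure law of the p-system `v_t - u_x = 0`, `u_t + p(v)_x = 0` in Lagrangean
coordinates, as a function of the specific volume `v = 1 / ρ`. -/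
noncomputable def pressure (v : ℝ) : ℝ := 1 / (3 * v ^ 3)

/-- The first Riemann invariant `w₁ = ρ - u`. -/
def w₁ (ρ u : ℝ) : ℝ := ρ - u

/-- The second Riemann invariant `w₂ = ρ + u`. -/
def w₂ (ρ u : ℝ) : ℝ := ρ + u

/-- The left state `(ρL, uL)` and the right state `(ρR, uR)` are joined by an admissible 1-shock:
for some speed `lam`, the Rankine-Hugoniot equations of the p-system hold, together with the Lax
condition for the first characteristic speed `-ρ ^ 2`. -/
def IsOneShock (ρL uL ρR uR : ℝ) : Prop :=
  0 < ρL ∧ 0 < ρR ∧ ∃ lam : ℝ,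
    lam * (ρR⁻¹ - ρL⁻¹) = uL - uR ∧
    lam * (uR - uL) = pressure ρR⁻¹ - pressure ρL⁻¹ ∧
    -ρR ^ 2 < lam ∧ lam < -ρL ^ 2

/-- The profile of `w₂` ahead of the shock: `0` for `x ≤ 0`, `x ^ α * (2 + sin (x ^ (-β)))` for
`0 < x ≤ δ`, and constant for `x ≥ δ`, written through the truncation of `x` to `[0, δ]`. -/
noncomputable def profile (α β δ x : ℝ) : ℝ :=
  (max 0 (min x δ)) ^ α * (2 + Real.sin ((max 0 (min x δ)) ^ (-β)))

/-- The initial datum: `w₁ = 0` and `w₂ = profile` to the left of the point `ξ`, a 1-shock of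
strength one (the size of the jump in `w₁`) at `ξ`, and a constant state to the right of `ξ`. -/
def IsInitialDatum (α β δ ξ : ℝ) (ρ₀ u₀ : ℝ → ℝ) : Prop :=
  (∀ x, x < ξ → w₁ (ρ₀ x) (u₀ x) = 0 ∧ w₂ (ρ₀ x) (u₀ x) = profile α β δ x) ∧
  ∃ ρL uL ρR uR : ℝ,
    w₁ ρL uL = 0 ∧ w₂ ρL uL = profile α β δ ξ ∧
    IsOneShock ρL uL ρR uR ∧ |w₁ ρR uR - w₁ ρL uL| = 1 ∧
    ∀ x, ξ < x → ρ₀ x = ρR ∧ u₀ x = uR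

/-- The space-time region, up to time `T`, to the left of the line `x = ξ - c * t`. -/
def leftRegion (c ξ T : ℝ) : Set (ℝ × ℝ) := {z | 0 ≤ z.1 ∧ z.1 < T ∧ z.2 < ξ - c * z.1}

/-- The space-time region, up to time `T`, to the right of the line `x = ξ - c * t`. -/
def rightRegion (c ξ T : ℝ) : Set (ℝ × ℝ) := {z | 0 ≤ z.1 ∧ z.1 < T ∧ ξ - c * z.1 < z.2}

/-- `(ρ, u)` is, on the time interval `[0, T)`, an approximate solution of the p-system with one
1-shock, issued from `ξ`, all of whose waves travel with speed `-c` (the 1-waves, among them the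
shock) or `c` (the 2-waves), while the strengths of the waves that leave the shock are exact.
Off the shock, a change in `w₁` is a 1-wave and a change in `w₂` is a 2-wave, so `w₁` is constant
along segments of speed `-c`, and `w₂` along segments of speed `c`, which stay on one side of the
shock. At each time the traces on the two sides of the shock are joined by an exact 1-shock of the
p-system. -/
structure IsApproxSolution (c ξ T : ℝ) (ρ u : ℝ → ℝ → ℝ) : Prop where
  density_nonneg : ∀ t x, 0 ≤ t → t < T → 0 ≤ ρ t x
  one_waves : ∀ s t y, 0 ≤ s → s ≤ t → t < T → y ≠ ξ - c * s →
    w₁ (ρ t (y - c * (t - s))) (u t (y - c * (t - s))) = w₁ (ρ s y) (u s y)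
  two_waves : ∀ s t y, 0 ≤ s → s ≤ t → t < T →
    (y + c * (t - s) < ξ - c * t ∨ ξ - c * s < y) →
    w₂ (ρ t (y + c * (t - s))) (u t (y + c * (t - s))) = w₂ (ρ s y) (u s y)
  shock : ∀ t, 0 ≤ t → t < T → ∃ ρL uL ρR uR : ℝ,
    Tendsto (fun z : ℝ × ℝ => (ρ z.1 z.2, u z.1 z.2))
      (𝓝[leftRegion c ξ T] (t, ξ - c * t)) (𝓝 (ρL, uL)) ∧
    Tendsto (fun z : ℝ × ℝ => (ρ z.1 z.2, u z.1 z.2))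
      (𝓝[rightRegion c ξ T] (t, ξ - c * t)) (𝓝 (ρR, uR)) ∧
    IsOneShock ρL uL ρR uR

/-- Total variation on the real line of a state, measured by the Riemann invariants. -/
noncomputable def totalVariation (ρ₀ u₀ : ℝ → ℝ) : ENNReal :=
  eVariationOn (fun x => w₁ (ρ₀ x) (u₀ x)) univ + eVariationOn (fun x => w₂ (ρ₀ x) (u₀ x)) univ

end PSystem

/-! Ahead of the shock `u = ρ`, and unit strength forces `w₁ = 1` behind it. With density `a` ahead
and density jump `s`, eliminating the shock speed from the Rankine-Hugoniot equations leaves `s ^ 4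
= 3 * a * (a + s) * (1 - 2 * s)` with `0 < s < 1 / 2`. This determines `s = jump a`, and near vacuum
`s ^ 3 ≈ 3 * a`, so that `jump` has slope asymptotic to `3 ^ (-2/3) * a ^ (-2/3)`
(`exists_jumpSlope_ge`). The value of `w₂` goes from `2 * a` to `behind a = 2 * (a + jump a) - 1`
across the shock, so its increments are multiplied by one plus an average slope; this gives the
amplification (`behind_amplification`).

Every approximate solution is determined off the shock line: tracing a 2-characteristic back to the
shock shows that on the right `w₂ = behind (profile / 2)`, transported with speed `c`
(`IsApproxSolution.right_w₂`). The same formulas define a solution.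

Between consecutive crests `x` of order `n ^ (-1/β)` the datum oscillates by about `x ^ α`, which is
summable because `β < α`. Amplification by `(x ^ α) ^ (-2/3)` turns this into `x ^ (α/3)`, of order
`n ^ (-α/(3β))`, which is not summable because `α / 3 < β`. Before time `T` only the part of the
datum beyond `ξ - 2 * c * t > 0` has crossed the shock; there the density is bounded away from zero,
`behind` is Lipschitz, and the variation is finite. As `t → T` all crests below `δ` eventually
cross. -/

namespace PSystem

/-! ### The density jump across a unit shock, as a function of the density ahead -/

/-- The relation between the density `a` ahead of a 1-shock of unit strength and the jump `s` of
the density across that shock. -/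
def JumpRel (a s : ℝ) : Prop :=
  0 < a ∧ 0 < s ∧ s < 1 / 2 ∧ s ^ 4 = 3 * a * (a + s) * (1 - 2 * s)

theorem exists_jumpRel {a : ℝ} (ha : 0 < a) : ∃ s, JumpRel a s := by
  have hc : ContinuousOn (fun s : ℝ => s ^ 4 - 3 * a * (a + s) * (1 - 2 * s)) (Icc 0 (1 / 2)) := by
    fun_prop
  have h := intermediate_value_Ioo (by norm_num : (0 : ℝ) ≤ 1 / 2) hc
  have h0 : (0 : ℝ) ∈ Ioo ((0 : ℝ) ^ 4 - 3 * a * (a + 0) * (1 - 2 * 0))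
      ((1 / 2 : ℝ) ^ 4 - 3 * a * (a + 1 / 2) * (1 - 2 * (1 / 2))) := by
    constructor
    · nlinarith [mul_pos ha ha]
    · norm_num
  obtain ⟨s, hs, hs'⟩ := h h0
  exact ⟨s, ha, hs.1, hs.2, by simpa [sub_eq_zero] using hs'⟩

/-- For fixed `a`, the quotient `s ^ 4 / ((a + s) * (1 - 2 * s))` increases with `s`, being a
product of the increasing factors `s ^ 3`, `s / (a + s)` and `1 / (1 - 2 * s)`. The proof is this
monotonicity with denominators cleared. Uniqueness and monotonicity of `jump` rest on it. -/
theorem JumpRel.lt {a₁ a₂ s₁ s₂ : ℝ} (h₁ : JumpRel a₁ s₁) (h₂ : JumpRel a₂ s₂) (h : s₂ < s₁) :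
    a₂ < a₁ := by
  obtain ⟨ha1, hs1, hs1', e1⟩ := h₁
  obtain ⟨ha2, hs2, hs2', e2⟩ := h₂
  by_contra! hle
  have p1 : 0 < 1 - 2 * s₁ := by linarith
  have p2 : 0 < 1 - 2 * s₂ := by linarith
  have k1 : 3 * a₁ * (a₁ + s₂) * (1 - 2 * s₂) ≤ s₂ ^ 4 := by
    rw [e2]; gcongr
  have k2 : s₁ ^ 4 * ((a₁ + s₂) * (1 - 2 * s₂)) ≤ s₂ ^ 4 * ((a₁ + s₁) * (1 - 2 * s₁)) := by
    have := mul_le_mul_of_nonneg_right k1 (by positivity : 0 ≤ (a₁ + s₁) * (1 - 2 * s₁))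
    rw [e1]; linarith
  have k3 : s₂ * (a₁ + s₁) < s₁ * (a₁ + s₂) := by nlinarith
  have k4 : s₂ ^ 3 < s₁ ^ 3 := by gcongr
  have k5 : 1 - 2 * s₁ < 1 - 2 * s₂ := by linarith
  have : s₂ ^ 3 * (s₂ * (a₁ + s₁)) * (1 - 2 * s₁) < s₁ ^ 3 * (s₁ * (a₁ + s₂)) * (1 - 2 * s₂) := by
    gcongr
  linarith

theorem JumpRel.right_unique {a s s' : ℝ} (h : JumpRel a s) (h' : JumpRel a s') : s = s' := by
  rcases lt_trichotomy s s' with hl | hl | hl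
  · exact absurd (h'.lt h hl) (lt_irrefl _)
  · exact hl
  · exact absurd (h.lt h' hl) (lt_irrefl _)

theorem JumpRel.left_unique {a a' s : ℝ} (h : JumpRel a s) (h' : JumpRel a' s) : a = a' := by
  obtain ⟨ha1, hs1, hs1', e1⟩ := h
  obtain ⟨ha2, -, -, e2⟩ := h'
  have p : 0 < 1 - 2 * s := by linarith
  have e : (a - a') * ((a + a' + s) * (1 - 2 * s)) = 0 := by linarith
  rcases mul_eq_zero.1 e with e | e
  · linarith
  · exact absurd e (by positivity)

/-- The jump of the density across the 1-shock of unit strength with density `a` ahead of it. -/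
noncomputable def jump (a : ℝ) : ℝ := if h : 0 < a then (exists_jumpRel h).choose else 0

theorem jumpRel_jump {a : ℝ} (ha : 0 < a) : JumpRel a (jump a) := by
  rw [jump, dif_pos ha]; exact (exists_jumpRel ha).choose_spec

theorem strictMonoOn_jump : StrictMonoOn jump (Ioi 0) := by
  intro a ha b hb hab
  by_contra! hle
  rcases hle.lt_or_eq with h | h
  · exact lt_asymm hab ((jumpRel_jump ha).lt (jumpRel_jump hb) h)
  · exact hab.ne ((jumpRel_jump ha).left_unique (h ▸ jumpRel_jump hb))

/-- The density ahead of a 1-shock of unit strength, as a function of the jump of the density. -/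
noncomputable def jumpInv (s : ℝ) : ℝ := (√(s ^ 2 + 4 * s ^ 4 / (3 * (1 - 2 * s))) - s) / 2

/-- For fixed `s` the relation is quadratic in `a`, so its positive root is explicit, whereas
solving for `s` would mean solving a quartic. Regularity of `jump` is therefore obtained from its
inverse. -/
theorem jumpRel_jumpInv {s : ℝ} (hs : 0 < s) (hs' : s < 1 / 2) : JumpRel (jumpInv s) s := by
  have p : 0 < 1 - 2 * s := by linarith
  have hpos : 0 < 4 * s ^ 4 / (3 * (1 - 2 * s)) := by positivity
  have hsq : √(s ^ 2 + 4 * s ^ 4 / (3 * (1 - 2 * s))) ^ 2 = s ^ 2 + 4 * s ^ 4 / (3 * (1 - 2 * s)) :=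
    Real.sq_sqrt (by positivity)
  have hlt : s < √(s ^ 2 + 4 * s ^ 4 / (3 * (1 - 2 * s))) := Real.lt_sqrt_of_sq_lt (by linarith)
  refine ⟨by unfold jumpInv; linarith, hs, hs', ?_⟩
  have : 3 * jumpInv s * (jumpInv s + s) =
      3 / 4 * (√(s ^ 2 + 4 * s ^ 4 / (3 * (1 - 2 * s))) ^ 2 - s ^ 2) := by
    unfold jumpInv; ring
  have h4 : 4 * s ^ 4 / (3 * (1 - 2 * s)) * (1 - 2 * s) = 4 / 3 * s ^ 4 := by
    rw [div_mul_eq_mul_div, div_eq_iff (by positivity)]; ring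
  rw [this, hsq, add_sub_cancel_left]
  linarith

theorem jump_jumpInv {s : ℝ} (hs : 0 < s) (hs' : s < 1 / 2) : jump (jumpInv s) = s :=
  (jumpRel_jump (jumpRel_jumpInv hs hs').1).right_unique (jumpRel_jumpInv hs hs')

theorem jumpInv_jump {a : ℝ} (ha : 0 < a) : jumpInv (jump a) = a := by
  have h := jumpRel_jump ha
  exact (jumpRel_jumpInv h.2.1 h.2.2.1).left_unique h

theorem continuousAt_jump {a : ℝ} (ha : 0 < a) : ContinuousAt jump a := by
  refine strictMonoOn_jump.continuousAt_of_image_mem_nhds (Ioi_mem_nhds ha) ?_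
  -- A monotone function has no jump discontinuity where its image fills a neighbourhood; here the
  -- image contains all of `(0, 1/2)`.
  have h := jumpRel_jump ha
  refine mem_of_superset (Ioo_mem_nhds h.2.1 h.2.2.1) fun s hs => ?_
  exact ⟨jumpInv s, (jumpRel_jumpInv hs.1 hs.2).1, jump_jumpInv hs.1 hs.2⟩

/-- The derivative of the jump at `a`, in terms of `a` and the jump `s`. -/
noncomputable def jumpSlope (a s : ℝ) : ℝ :=
  (2 * a + s) / (a * (3 + 4 * a / s + 2 * (a + s) / (1 - 2 * s)))

theorem JumpRel.jumpSlope_pos {a s : ℝ} (h : JumpRel a s) : 0 < jumpSlope a s := by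
  obtain ⟨ha, hs, hs', -⟩ := h
  have p : 0 < 1 - 2 * s := by linarith
  unfold jumpSlope
  positivity

/-- The explicit root only serves to give differentiability; the value of the derivative comes from
differentiating the relation implicitly. -/
theorem hasDerivAt_jumpInv {s : ℝ} (hs : 0 < s) (hs' : s < 1 / 2) :
    HasDerivAt jumpInv (jumpSlope (jumpInv s) s)⁻¹ s := by
  have p : 0 < 1 - 2 * s := by linarith
  have hd : DifferentiableAt ℝ jumpInv s := by
    have h1 : DifferentiableAt ℝ (fun s : ℝ => s ^ 2 + 4 * s ^ 4 / (3 * (1 - 2 * s))) s := by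
      fun_prop (disch := positivity)
    exact ((h1.sqrt (by positivity)).sub differentiableAt_id).div_const 2
  set d := deriv jumpInv s with hdd
  have hd' : HasDerivAt jumpInv d s := hd.hasDerivAt
  have e1 : HasDerivAt (fun s => 3 * jumpInv s * (jumpInv s + s) * (1 - 2 * s))
      ((3 * d * (jumpInv s + s) + 3 * jumpInv s * (d + 1)) * (1 - 2 * s) +
        3 * jumpInv s * (jumpInv s + s) * (-2)) s := by
    have h2 : HasDerivAt (fun s : ℝ => 1 - 2 * s) (-2) s := by
      simpa using ((hasDerivAt_id s).const_mul 2).const_sub 1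
    exact ((hd'.const_mul 3).mul (hd'.add (hasDerivAt_id s))).mul h2
  have e2 : HasDerivAt (fun s => 3 * jumpInv s * (jumpInv s + s) * (1 - 2 * s)) (4 * s ^ 3) s := by
    have := hasDerivAt_pow 4 s
    norm_num at this
    refine this.congr_of_eventuallyEq ?_
    filter_upwards [Ioo_mem_nhds hs hs'] with x hx
    exact (jumpRel_jumpInv hx.1 hx.2).2.2.2.symm
  have key := e1.unique e2
  obtain ⟨ha, -, -, e⟩ := jumpRel_jumpInv hs hs'
  generalize jumpInv s = a at *
  have : d = (jumpSlope a s)⁻¹ := by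
    unfold jumpSlope
    rw [inv_div, eq_div_iff (by positivity)]
    have k : s * d * 3 * (2 * a + s) * (1 - 2 * s) =
        4 * (3 * a * (a + s) * (1 - 2 * s)) - 3 * a * (1 - 2 * s) * s + 6 * a * (a + s) * s := by
      rw [← e]; linear_combination s * key
    field_simp
    linear_combination k / 3
  exact this ▸ hd'

theorem hasDerivAt_jump {a : ℝ} (ha : 0 < a) : HasDerivAt jump (jumpSlope a (jump a)) a := by
  have h := jumpRel_jump ha
  have h1 := hasDerivAt_jumpInv h.2.1 h.2.2.1
  rw [jumpInv_jump ha] at h1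
  have := HasDerivAt.of_local_left_inverse (continuousAt_jump ha) h1 (inv_ne_zero h.jumpSlope_pos.ne')
    (by filter_upwards [Ioi_mem_nhds ha] with y hy using jumpInv_jump hy)
  simpa using this

/-- The bracket in the denominator is at least `3`, and `s < 1 / 2`. The bound is crude, but it is
finite away from vacuum, which is all the Lipschitz estimate needs. -/
theorem JumpRel.jumpSlope_le {a s : ℝ} (h : JumpRel a s) : jumpSlope a s ≤ 1 + 1 / a := by
  obtain ⟨ha, hs, hs', -⟩ := h
  have p : 0 < 1 - 2 * s := by linarith
  unfold jumpSlope
  rw [div_le_iff₀ (by positivity)]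
  have h3 : 3 ≤ 3 + 4 * a / s + 2 * (a + s) / (1 - 2 * s) := by
    have : 0 < 4 * a / s := by positivity
    have : 0 < 2 * (a + s) / (1 - 2 * s) := by positivity
    linarith
  have : (1 + 1 / a) * (a * 3) ≤ (1 + 1 / a) * (a * (3 + 4 * a / s + 2 * (a + s) / (1 - 2 * s))) := by
    gcongr
  have e : (1 + 1 / a) * (a * 3) = 3 * a + 3 := by field_simp
  linarith

/-- Dropping `a` from `a + s` in the relation gives `3 * (1 - 2 * s) * a ≤ s ^ 3`. This bounds `s`
below by a multiple of `a ^ (1/3)`, and bounds `a` and `a / s` above in terms of `s`. The resulting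
coefficient depends on `s` alone and tends to `3 ^ (-2/3)` as `s → 0`. -/
theorem JumpRel.jumpSlope_ge {a s : ℝ} (h : JumpRel a s) :
    (3 * (1 - 2 * s)) ^ (1 / 3 : ℝ) /
      (3 + 4 * (s ^ 2 / (3 * (1 - 2 * s))) + 2 * (s ^ 3 / (3 * (1 - 2 * s)) + s) / (1 - 2 * s)) *
      a ^ (-(2 / 3) : ℝ) ≤ jumpSlope a s := by
  obtain ⟨ha, hs, hs', e⟩ := h
  have p : 0 < 1 - 2 * s := by linarith
  have h3 : a ≤ s ^ 3 / (3 * (1 - 2 * s)) := by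
    rw [le_div_iff₀ (by positivity)]
    have : a * (3 * (1 - 2 * s)) * s ≤ s ^ 3 * s := by
      have : 0 < a * a * (1 - 2 * s) := by positivity
      nlinarith
    exact le_of_mul_le_mul_right this hs
  have h2 : a / s ≤ s ^ 2 / (3 * (1 - 2 * s)) := by
    rw [div_le_iff₀ hs]
    calc a ≤ _ := h3
      _ = _ := by ring
  have h1 : (3 * (1 - 2 * s)) ^ (1 / 3 : ℝ) * a ^ (1 / 3 : ℝ) ≤ s := by
    rw [← Real.mul_rpow (by positivity) ha.le]
    calc (3 * (1 - 2 * s) * a) ^ (1 / 3 : ℝ) ≤ (s ^ 3) ^ (1 / 3 : ℝ) := by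
          gcongr
          rw [le_div_iff₀ (by positivity)] at h3
          linarith
      _ = s := by
          rw [← Real.rpow_natCast, ← Real.rpow_mul hs.le]; norm_num
  have ha3 : a ^ (-(2 / 3) : ℝ) = a ^ (1 / 3 : ℝ) / a := by
    rw [show (-(2 / 3) : ℝ) = 1 / 3 - 1 by norm_num, Real.rpow_sub_one ha.ne']
  unfold jumpSlope
  rw [ha3, div_mul_div_comm, mul_comm a]
  have : 4 * a / s = 4 * (a / s) := by ring
  rw [this]
  gcongr
  linarith

theorem exists_jumpSlope_ge {κ : ℝ} (hκ : κ < (3 : ℝ) ^ (-(2 / 3) : ℝ)) :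
    ∃ a₀ > 0, ∀ a, 0 < a → a < a₀ → κ * a ^ (-(2 / 3) : ℝ) ≤ jumpSlope a (jump a) := by
  have hc : ContinuousAt (fun s : ℝ => (3 * (1 - 2 * s)) ^ (1 / 3 : ℝ) /
      (3 + 4 * (s ^ 2 / (3 * (1 - 2 * s))) +
        2 * (s ^ 3 / (3 * (1 - 2 * s)) + s) / (1 - 2 * s))) 0 := by
    have h1 : ContinuousAt (fun s : ℝ => (3 * (1 - 2 * s)) ^ (1 / 3 : ℝ)) 0 :=
      ContinuousAt.rpow_const (by fun_prop) (by norm_num)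
    refine h1.div ?_ (by norm_num)
    fun_prop (disch := norm_num)
  have h0 : (3 : ℝ) ^ (-(2 / 3) : ℝ) = 3 ^ (1 / 3 : ℝ) / 3 := by
    rw [show (-(2 / 3) : ℝ) = 1 / 3 - 1 by norm_num, Real.rpow_sub_one (by norm_num)]
  have hev := hc.eventually_const_lt (u := κ) (by norm_num at h0 hκ ⊢; rw [← h0]; exact hκ)
  obtain ⟨ε, hε, hball⟩ := Metric.eventually_nhds_iff.1 hev
  set s₀ := min ε (1 / 2) / 2 with hs0
  have hm : 0 < min ε (1 / 2) := by positivity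
  have hs0p : 0 < s₀ := by positivity
  have hs0h : s₀ < 1 / 2 := by
    have := min_le_right ε (1 / 2); linarith
  have hs0e : s₀ < ε := by
    have := min_le_left ε (1 / 2); linarith
  -- Monotonicity of `jump` converts the smallness threshold on `s` into one on `a`.
  refine ⟨jumpInv s₀, (jumpRel_jumpInv hs0p hs0h).1, fun a ha hlt => ?_⟩
  have h := jumpRel_jump ha
  have hs : jump a < s₀ := by
    rw [← jump_jumpInv hs0p hs0h]
    exact strictMonoOn_jump ha (jumpRel_jumpInv hs0p hs0h).1 hlt
  refine le_trans ?_ h.jumpSlope_ge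
  gcongr
  refine (hball ?_).le
  rw [Real.dist_eq, sub_zero, abs_of_pos h.2.1]
  linarith

/-! ### The transmission map for `w₂`: Lipschitz bound and amplification -/

/-- The value of `w₂` behind the 1-shock of unit strength with density `a` ahead of it. -/
noncomputable def behind (a : ℝ) : ℝ := 2 * (a + jump a) - 1

theorem hasDerivAt_behind {a : ℝ} (ha : 0 < a) :
    HasDerivAt behind (2 * (1 + jumpSlope a (jump a))) a :=
  (((hasDerivAt_id a).add (hasDerivAt_jump ha)).const_mul 2).sub_const 1

theorem behind_lipschitz {m a b : ℝ} (hm : 0 < m) (ha : m ≤ a) (hb : m ≤ b) :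
    |behind b - behind a| ≤ 2 * (2 + 1 / m) * |b - a| := by
  have := (convex_Ici m).norm_image_sub_le_of_norm_hasDerivWithin_le
    (f := behind) (C := 2 * (2 + 1 / m))
    (fun x hx => (hasDerivAt_behind (hm.trans_le hx)).hasDerivWithinAt)
    (fun x hx => ?_) ha hb
  · simpa only [Real.norm_eq_abs] using this
  · have hx0 := hm.trans_le hx
    have h := jumpRel_jump hx0
    have h1 := h.jumpSlope_pos
    have h2 := h.jumpSlope_le
    have h3 : 1 / x ≤ 1 / m := one_div_le_one_div_of_le hm hx
    rw [Real.norm_eq_abs, abs_of_pos (by positivity)]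
    linarith

/-- Mean value inequality on `[a, b]`: `x ^ (-2/3)` is decreasing, so the lower bound for the slope
is worst at the larger density, hence the maximum. For `κ ≤ 0` there is nothing to prove. -/
theorem behind_amplification {κ a₀ : ℝ}
    (h₀ : ∀ a, 0 < a → a < a₀ → κ * a ^ (-(2 / 3) : ℝ) ≤ jumpSlope a (jump a)) {a b : ℝ}
    (ha : 0 < a) (ha₀ : a < a₀) (hb : 0 < b) (hb₀ : b < a₀) :
    κ * (max a b) ^ (-(2 / 3) : ℝ) * |2 * a - 2 * b| ≤ |behind a - behind b| := by
  wlog hab : a ≤ b generalizing a b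
  · have := this hb hb₀ ha ha₀ (le_of_not_ge hab)
    rwa [max_comm, abs_sub_comm, abs_sub_comm (behind a)]
  rcases le_or_gt κ 0 with hκ | hκ
  · refine le_trans ?_ (abs_nonneg _)
    have : 0 ≤ (max a b) ^ (-(2 / 3) : ℝ) := by positivity
    exact mul_nonpos_of_nonpos_of_nonneg (mul_nonpos_of_nonpos_of_nonneg hκ this) (abs_nonneg _)
  have hd : ∀ x ∈ Icc a b, HasDerivAt behind (2 * (1 + jumpSlope x (jump x))) x :=
    fun x hx => hasDerivAt_behind (ha.trans_le hx.1)
  have := (convex_Icc a b).mul_sub_le_image_sub_of_le_deriv (f := behind)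
    (C := 2 * (κ * b ^ (-(2 / 3) : ℝ)))
    (fun x hx => (hd x hx).continuousAt.continuousWithinAt)
    (fun x hx => (hd x (interior_subset hx)).differentiableAt.differentiableWithinAt)
    (fun x hx => ?_) a (left_mem_Icc.2 hab) b (right_mem_Icc.2 hab) hab
  · rw [max_eq_right hab, abs_sub_comm, abs_sub_comm (behind a),
      abs_of_nonneg (by linarith : 0 ≤ 2 * b - 2 * a)]
    refine le_trans ?_ (le_abs_self _)
    linarith
  · have hx' := interior_subset hx
    have hx0 : 0 < x := ha.trans_le hx'.1
    rw [(hd x hx').deriv]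
    have h1 := h₀ x hx0 (hx'.2.trans_lt hb₀)
    have h2 : b ^ (-(2 / 3) : ℝ) ≤ x ^ (-(2 / 3) : ℝ) :=
      Real.rpow_le_rpow_of_nonpos hx0 hx'.2 (by norm_num)
    have h3 := mul_le_mul_of_nonneg_left h2 hκ.le
    linarith

/-! ### Unit shocks and the Rankine-Hugoniot equations -/

theorem isOneShock_jump {a : ℝ} (ha : 0 < a) :
    IsOneShock a a (a + jump a) (a + jump a - 1) := by
  obtain ⟨-, hs, hs', e⟩ := jumpRel_jump ha
  generalize jump a = s at *
  have p : 0 < 1 - 2 * s := by linarith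
  have q : 0 < 1 - s := by linarith
  have k : 3 * a * (a + s) * (1 - s) ^ 2 = s ^ 2 * (s ^ 2 + 3 * a * (a + s)) := by
    linear_combination -e
  -- The speed is the one dictated by the first Rankine-Hugoniot equation.
  refine ⟨ha, by positivity, -((1 - s) * a * (a + s) / s), ?_, ?_, ?_, ?_⟩
  · field_simp
    ring
  · unfold pressure
    field_simp
    linear_combination k
  · rw [neg_lt_neg_iff, div_lt_iff₀ hs]
    have : (1 - s) * a < (a + s) * s := by
      -- Squaring produces the factor `(1 - s) ^ 2`, which the relation `k` can replace.
      refine lt_of_pow_lt_pow_left₀ 2 (by positivity) ?_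
      have : 3 * (a + s) * ((1 - s) * a) ^ 2 < 3 * (a + s) * ((a + s) * s) ^ 2 := by
        have e' : 3 * (a + s) * ((1 - s) * a) ^ 2 = a * (s ^ 2 * (s ^ 2 + 3 * a * (a + s))) := by
          rw [← k]; ring
        rw [e']
        have : 0 < s ^ 2 * (3 * (a + s) ^ 3 - a * (s ^ 2 + 3 * a * (a + s))) := by
          have : 3 * (a + s) ^ 3 - a * (s ^ 2 + 3 * a * (a + s)) =
            6 * a ^ 2 * s + 8 * a * s ^ 2 + 3 * s ^ 3 := by ring
          rw [this]; positivity
        linarith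
      exact lt_of_mul_lt_mul_left this (by positivity)
    nlinarith
  · rw [neg_lt_neg_iff, lt_div_iff₀ hs]
    have : a * s < (1 - s) * (a + s) := by nlinarith
    nlinarith

/-- The Lax condition puts `-lam` between `ρL ^ 2` and `ρR ^ 2`, so the density increases and `lam <
0`; then `u` decreases and `w₁` increases, which settles the sign of the unit jump. Eliminating
`lam` leaves the quartic relation, whose sign forces `s < 1 / 2`, and uniqueness of its root
concludes. -/
theorem IsOneShock.jump_eq {ρL uL ρR uR : ℝ} (h : IsOneShock ρL uL ρR uR)
    (hL : w₁ ρL uL = 0) (hR : |w₁ ρR uR - w₁ ρL uL| = 1) :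
    w₁ ρR uR = 1 ∧ w₂ ρR uR = behind ρL := by
  obtain ⟨ha, hb, lam, e1, e2, l1, l2⟩ := h
  have hab : ρL < ρR := lt_of_pow_lt_pow_left₀ 2 hb.le (by linarith)
  have hlam : lam < 0 := by nlinarith
  set s := ρR - ρL with hs
  have hs0 : 0 < s := by linarith
  have hd : (uL - uR) * (ρL * ρR) = -lam * s := by
    rw [← e1, hs]; field_simp; ring
  have hu : 0 < uL - uR := by
    have : 0 < (uL - uR) * (ρL * ρR) := by rw [hd]; nlinarith
    exact pos_of_mul_pos_left this (by positivity)
  rw [hL, sub_zero] at hR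
  unfold w₁ at hL hR
  have hw : ρR - uR = 1 := by
    rw [abs_of_pos (by linarith)] at hR; exact hR
  have hp : lam * (uR - uL) * 3 = ρR ^ 3 - ρL ^ 3 := by
    rw [e2]; unfold pressure; field_simp
  have hus : uL - uR = 1 - s := by linarith
  rw [hus] at hd hu
  have k : 3 * ρL * ρR * (1 - s) ^ 2 = s ^ 2 * (s ^ 2 + 3 * ρL * ρR) := by
    have hp' : -lam * (1 - s) * 3 = ρR ^ 3 - ρL ^ 3 := by rw [← hus]; linarith
    have : ρR ^ 3 - ρL ^ 3 = s * (s ^ 2 + 3 * ρL * ρR) := by rw [hs]; ring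
    rw [this] at hp'
    linear_combination 3 * (1 - s) * hd + s * hp'
  have e : s ^ 4 = 3 * ρL * (ρL + s) * (1 - 2 * s) := by
    have : ρR = ρL + s := by linarith
    rw [← this]; linear_combination -k
  have hs2 : s < 1 / 2 := by
    have h4 : 0 < 3 * ρL * (ρL + s) * (1 - 2 * s) := by rw [← e]; positivity
    have := pos_of_mul_pos_right h4 (by positivity)
    linarith
  have hj : s = jump ρL := JumpRel.right_unique ⟨ha, hs0, hs2, e⟩ (jumpRel_jump ha)
  refine ⟨hw, ?_⟩
  unfold w₂ behind
  linarith

/-! ### A criterion for finite total variation -/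

/-- `f` is dominated by a bounded monotone function, whose increments bound those of `f`. -/
def MonotoneControlled (f : ℝ → ℝ) (s : Set ℝ) : Prop :=
  ∃ (m : ℝ → ℝ) (B : ℝ), (∀ x ∈ s, |m x| ≤ B ∧ |f x| ≤ B) ∧
    ∀ x ∈ s, ∀ y ∈ s, x ≤ y → |f y - f x| ≤ m y - m x

theorem MonotoneControlled.eVariationOn_lt_top {f : ℝ → ℝ} {s : Set ℝ}
    (h : MonotoneControlled f s) : eVariationOn f s < ⊤ := by
  obtain ⟨m, B, hB, hm⟩ := h
  refine lt_of_le_of_lt (iSup_le ?_) (ENNReal.ofReal_lt_top (r := 2 * B))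
  rintro ⟨n, u, hu, hus⟩
  have key : ∀ k, ∑ i ∈ Finset.range k, edist (f (u (i + 1))) (f (u i)) ≤
      ENNReal.ofReal (m (u k) - m (u 0)) := by
    intro k
    induction k with
    | zero => simp
    | succ k ih =>
      have h1 := hm _ (hus k) _ (hus (k + 1)) (hu k.le_succ)
      have h2 := (abs_nonneg _).trans (hm _ (hus 0) _ (hus k) (hu k.zero_le))
      rw [Finset.sum_range_succ]
      calc _ ≤ ENNReal.ofReal (m (u k) - m (u 0)) + ENNReal.ofReal (m (u (k + 1)) - m (u k)) := by
            gcongr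
            rw [edist_dist, Real.dist_eq]
            exact ENNReal.ofReal_le_ofReal h1
        _ = _ := by
            rw [← ENNReal.ofReal_add h2 ((abs_nonneg _).trans h1)]
            congr 1; ring
  refine (key n).trans (ENNReal.ofReal_le_ofReal ?_)
  have h1 := abs_le.1 (hB _ (hus n)).1
  have h2 := abs_le.1 (hB _ (hus 0)).1
  linarith

/-- The value at `p` is arbitrary, since nothing prescribes an approximate solution on the shock
line itself. The majorant jumps up before and after `p` by enough to absorb any change of `f` there.
-/
theorem MonotoneControlled.glue {f : ℝ → ℝ} {p : ℝ} (h₁ : MonotoneControlled f (Iio p))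
    (h₂ : MonotoneControlled f (Ioi p)) : MonotoneControlled f univ := by
  obtain ⟨m₁, B₁, hB₁, hm₁⟩ := h₁
  obtain ⟨m₂, B₂, hB₂, hm₂⟩ := h₂
  have b1 : 0 ≤ B₁ := (abs_nonneg _).trans (hB₁ (p - 1) (by simp)).1
  have b2 : 0 ≤ B₂ := (abs_nonneg _).trans (hB₂ (p + 1) (by simp)).1
  have b3 : 0 ≤ |f p| := abs_nonneg _
  have k1 : ∀ x < p, -B₁ ≤ m₁ x ∧ m₁ x ≤ B₁ ∧ -B₁ ≤ f x ∧ f x ≤ B₁ := fun x hx =>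
    ⟨(abs_le.1 (hB₁ x hx).1).1, (abs_le.1 (hB₁ x hx).1).2, (abs_le.1 (hB₁ x hx).2).1,
      (abs_le.1 (hB₁ x hx).2).2⟩
  have k2 : ∀ x > p, -B₂ ≤ m₂ x ∧ m₂ x ≤ B₂ ∧ -B₂ ≤ f x ∧ f x ≤ B₂ := fun x hx =>
    ⟨(abs_le.1 (hB₂ x hx).1).1, (abs_le.1 (hB₂ x hx).1).2, (abs_le.1 (hB₂ x hx).2).1,
      (abs_le.1 (hB₂ x hx).2).2⟩
  have k3 : -|f p| ≤ f p ∧ f p ≤ |f p| := ⟨neg_abs_le _, le_abs_self _⟩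
  refine ⟨fun x => if x < p then m₁ x else if x = p then 2 * B₁ + |f p|
    else 4 * B₁ + 2 * |f p| + 2 * B₂ + m₂ x, 4 * B₁ + 2 * |f p| + 3 * B₂, ?_, ?_⟩
  · intro x _
    rcases lt_trichotomy x p with hx | rfl | hx
    · obtain ⟨c1, c2, c3, c4⟩ := k1 x hx
      simp only [if_pos hx]
      exact ⟨abs_le.2 ⟨by linarith, by linarith⟩, abs_le.2 ⟨by linarith, by linarith⟩⟩
    · simp only [lt_irrefl, if_false, if_true]
      exact ⟨abs_le.2 ⟨by linarith, by linarith⟩, abs_le.2 ⟨by linarith, by linarith⟩⟩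
    · obtain ⟨c1, c2, c3, c4⟩ := k2 x hx
      simp only [if_neg hx.not_gt, if_neg hx.ne']
      exact ⟨abs_le.2 ⟨by linarith, by linarith⟩, abs_le.2 ⟨by linarith, by linarith⟩⟩
  · intro x _ y _ hxy
    rcases lt_trichotomy x p with hx | rfl | hx
    · obtain ⟨c1, c2, c3, c4⟩ := k1 x hx
      rcases lt_trichotomy y p with hy | rfl | hy
      · simpa only [if_pos hx, if_pos hy] using hm₁ x hx y hy hxy
      · simp only [if_pos hx, lt_irrefl, if_false, if_true]
        exact abs_le.2 ⟨by linarith, by linarith⟩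
      · obtain ⟨d1, d2, d3, d4⟩ := k2 y hy
        simp only [if_pos hx, if_neg hy.not_gt, if_neg hy.ne']
        exact abs_le.2 ⟨by linarith, by linarith⟩
    · rcases hxy.eq_or_lt with rfl | hy
      · simp
      · obtain ⟨d1, d2, d3, d4⟩ := k2 y hy
        simp only [lt_irrefl, if_false, if_true, if_neg hy.not_gt, if_neg hy.ne']
        exact abs_le.2 ⟨by linarith, by linarith⟩
    · have hy : p < y := hx.trans_le hxy
      simp only [if_neg hx.not_gt, if_neg hx.ne', if_neg hy.not_gt, if_neg hy.ne']
      have := hm₂ x hx y hy hxy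
      linarith

theorem monotoneControlled_of_eqOn_const {f : ℝ → ℝ} {s : Set ℝ} {b : ℝ} (h : ∀ x ∈ s, f x = b) :
    MonotoneControlled f s := by
  refine ⟨fun _ => 0, |b|, fun x hx => ⟨by simp, by rw [h x hx]⟩, fun x hx y hy _ => ?_⟩
  simp [h x hx, h y hy]

theorem MonotoneControlled.shift {f g : ℝ → ℝ} {s : Set ℝ} {r : ℝ}
    (hf : MonotoneControlled f univ) (h : ∀ x ∈ s, g x = f (x - r)) : MonotoneControlled g s := by
  obtain ⟨m, B, hB, hm⟩ := hf
  refine ⟨fun x => m (x - r), B, fun x hx => ?_, fun x hx y hy hxy => ?_⟩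
  · rw [h x hx]; exact hB _ trivial
  · rw [h x hx, h y hy]; exact hm _ trivial _ trivial (by linarith)

theorem MonotoneControlled.comp_lipschitz {f g G : ℝ → ℝ} {s : Set ℝ} {r K : ℝ} (hK : 0 ≤ K)
    (hf : MonotoneControlled f univ) (h : ∀ x ∈ s, g x = G (f (x - r)))
    (hG : ∀ x ∈ s, ∀ y ∈ s, |G (f (y - r)) - G (f (x - r))| ≤ K * |f (y - r) - f (x - r)|) :
    MonotoneControlled g s := by
  obtain ⟨m, B, hB, hm⟩ := hf
  rcases s.eq_empty_or_nonempty with rfl | ⟨x₀, hx₀⟩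
  · exact ⟨fun _ => 0, 0, by simp, by simp⟩
  have hB0 : 0 ≤ B := (abs_nonneg _).trans (hB 0 trivial).1
  have hKB : 0 ≤ K * B := by positivity
  refine ⟨fun x => K * m (x - r), |g x₀| + 2 * (K * B), fun x hx => ⟨?_, ?_⟩, fun x hx y hy hxy => ?_⟩
  · rw [abs_mul, abs_of_nonneg hK]
    have := mul_le_mul_of_nonneg_left (hB (x - r) trivial).1 hK
    have := abs_nonneg (g x₀)
    linarith
  · have h1 := hG x₀ hx₀ x hx
    rw [← h x₀ hx₀, ← h x hx] at h1
    have h2 : |f (x - r) - f (x₀ - r)| ≤ B + B :=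
      (abs_sub _ _).trans (add_le_add (hB _ trivial).2 (hB _ trivial).2)
    have h3 := mul_le_mul_of_nonneg_left h2 hK
    have h4 := abs_sub_abs_le_abs_sub (g x) (g x₀)
    linarith
  · rw [h x hx, h y hy, ← mul_sub]
    exact (hG x hx y hy).trans
      (mul_le_mul_of_nonneg_left (hm _ trivial _ trivial (by linarith)) hK)

/-! ### The initial profile and its finite variation -/

/-- The untruncated profile. -/
noncomputable def wave (α β x : ℝ) : ℝ := x ^ α * (2 + Real.sin (x ^ (-β)))

theorem profile_eq_wave (α β δ x : ℝ) : profile α β δ x = wave α β (max 0 (min x δ)) := rfl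

theorem profile_of_mem {α β δ x : ℝ} (h0 : 0 ≤ x) (h : x ≤ δ) :
    profile α β δ x = wave α β x := by
  rw [profile_eq_wave, min_eq_left h, max_eq_right h0]

theorem le_wave {α β x : ℝ} (h : 0 ≤ x) : x ^ α ≤ wave α β x := by
  have h1 : 0 ≤ x ^ α := by positivity
  have h2 := Real.neg_one_le_sin (x ^ (-β))
  unfold wave; nlinarith

theorem wave_le {α β x : ℝ} (h : 0 ≤ x) : wave α β x ≤ 3 * x ^ α := by
  have h1 : 0 ≤ x ^ α := by positivity
  have h2 := Real.sin_le_one (x ^ (-β))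
  unfold wave; nlinarith

theorem profile_nonneg (α β δ x : ℝ) : 0 ≤ profile α β δ x := by
  have h : 0 ≤ max 0 (min x δ) := le_max_left _ _
  exact le_trans (by positivity) (le_wave h)

theorem profile_ge {α β δ q x : ℝ} (hα : 0 < α) (hq : 0 ≤ q) (hδ : q ≤ δ) (hx : q ≤ x) :
    q ^ α ≤ profile α β δ x := by
  have h : q ≤ max 0 (min x δ) := (le_min hx hδ).trans (le_max_right _ _)
  rw [profile_eq_wave]
  exact le_trans (by gcongr) (le_wave (hq.trans h))

theorem profile_pos {α β δ x : ℝ} (hα : 0 < α) (hδ : 0 < δ) (hx : 0 < x) :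
    0 < profile α β δ x :=
  (Real.rpow_pos_of_pos (lt_min hx hδ) α).trans_le
    (profile_ge hα (lt_min hx hδ).le (min_le_right _ _) (min_le_left _ _))

theorem profile_le {α β δ x : ℝ} (hα : 0 < α) (hδ : 0 < δ) : profile α β δ x ≤ 3 * δ ^ α := by
  have h0 : 0 ≤ max 0 (min x δ) := le_max_left _ _
  have h1 : max 0 (min x δ) ≤ δ := max_le hδ.le (min_le_right _ _)
  rw [profile_eq_wave]
  exact (wave_le h0).trans (by gcongr)

theorem hasDerivAt_wave (α β : ℝ) {x : ℝ} (hx : 0 < x) :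
    HasDerivAt (wave α β) (α * x ^ (α - 1) * (2 + Real.sin (x ^ (-β))) -
      β * x ^ (α - β - 1) * Real.cos (x ^ (-β))) x := by
  have h1 := Real.hasDerivAt_rpow_const (x := x) (p := α) (Or.inl hx.ne')
  have h2 := Real.hasDerivAt_rpow_const (x := x) (p := -β) (Or.inl hx.ne')
  have h3 := h1.mul (h2.sin.const_add 2)
  refine h3.congr_deriv ?_
  have : x ^ (α - β - 1) = x ^ α * x ^ (-β - 1) := by
    rw [← Real.rpow_add hx]; congr 1; ring
  rw [this]
  ring

theorem continuousAt_profile {α β δ x : ℝ} (hδ : 0 < δ) (hx : 0 < x) :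
    ContinuousAt (profile α β δ) x := by
  have h : 0 < max 0 (min x δ) := (lt_min hx hδ).trans_le (le_max_right _ _)
  exact (hasDerivAt_wave α β h).continuousAt.comp (f := fun x => max 0 (min x δ)) (by fun_prop)

theorem continuousOn_wave {α β : ℝ} (hα : 0 < α) : ContinuousOn (wave α β) (Ici 0) := by
  intro x hx
  rcases (mem_Ici.1 hx).eq_or_lt with rfl | hx
  · have h0 : wave α β 0 = 0 := by simp [wave, Real.zero_rpow hα.ne']
    have hc : Tendsto (fun x : ℝ => 3 * x ^ α) (𝓝[Ici 0] 0) (𝓝 0) := by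
      have : ContinuousAt (fun x : ℝ => 3 * x ^ α) 0 :=
        continuousAt_const.mul (Real.continuousAt_rpow_const _ _ (Or.inr hα.le))
      have := this.continuousWithinAt (s := Ici 0)
      simpa [ContinuousWithinAt, Real.zero_rpow hα.ne'] using this
    rw [ContinuousWithinAt, h0]
    refine tendsto_of_tendsto_of_tendsto_of_le_of_le' tendsto_const_nhds hc ?_ ?_
    · filter_upwards [self_mem_nhdsWithin] with y hy
      have : 0 ≤ y := hy
      exact le_trans (by positivity) (le_wave hy)
    · filter_upwards [self_mem_nhdsWithin] with y hy using wave_le hy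
  · exact (hasDerivAt_wave α β hx).continuousAt.continuousWithinAt

/-- A monotone function that controls the increments of `wave`. -/
noncomputable def waveBound (α β x : ℝ) : ℝ := 3 * x ^ α + β / (α - β) * x ^ (α - β)

theorem hasDerivAt_waveBound {α β : ℝ} (hβα : β < α) {x : ℝ} (hx : 0 < x) :
    HasDerivAt (waveBound α β) (3 * α * x ^ (α - 1) + β * x ^ (α - β - 1)) x := by
  have h1 := Real.hasDerivAt_rpow_const (x := x) (p := α) (Or.inl hx.ne')
  have h2 := Real.hasDerivAt_rpow_const (x := x) (p := α - β) (Or.inl hx.ne')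
  refine ((h1.const_mul 3).add (h2.const_mul (β / (α - β)))).congr_deriv ?_
  have : α - β ≠ 0 := by linarith
  field_simp

theorem continuous_waveBound {α β : ℝ} (hα : 0 < α) (hβα : β < α) :
    Continuous (waveBound α β) := by
  unfold waveBound
  exact (continuous_const.mul (Real.continuous_rpow_const hα.le)).add
    (continuous_const.mul (Real.continuous_rpow_const (by linarith)))

/-- The derivative of `waveBound` dominates the absolute value of that of `wave`, so `waveBound -
wave` and `waveBound + wave` are both monotone. The condition `β < α` makes the bound continuous at
`0`. -/
theorem abs_wave_sub_le {α β : ℝ} (hα : 0 < α) (hβ : 0 < β) (hβα : β < α) {x y : ℝ} (hx : 0 ≤ x)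
    (hxy : x ≤ y) : |wave α β y - wave α β x| ≤ waveBound α β y - waveBound α β x := by
  have hb : ∀ z : ℝ, 0 < z → |α * z ^ (α - 1) * (2 + Real.sin (z ^ (-β))) -
      β * z ^ (α - β - 1) * Real.cos (z ^ (-β))| ≤
      3 * α * z ^ (α - 1) + β * z ^ (α - β - 1) := by
    intro z hz
    have p1 : 0 < α * z ^ (α - 1) := by positivity
    have p2 : 0 < β * z ^ (α - β - 1) := by positivity
    have s1 := Real.sin_le_one (z ^ (-β))
    have s2 := Real.neg_one_le_sin (z ^ (-β))
    have c1 := Real.cos_le_one (z ^ (-β))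
    have c2 := Real.neg_one_le_cos (z ^ (-β))
    exact abs_le.2 ⟨by nlinarith, by nlinarith⟩
  have m1 : MonotoneOn (fun z => waveBound α β z - wave α β z) (Ici 0) := by
    refine monotoneOn_of_deriv_nonneg (convex_Ici 0)
      ((continuous_waveBound hα hβα).continuousOn.sub (continuousOn_wave hα)) ?_ ?_ <;>
      intro z hz <;> rw [interior_Ici] at hz <;>
      have hd := (hasDerivAt_waveBound hβα hz).sub (hasDerivAt_wave α β hz)
    · exact hd.differentiableAt.differentiableWithinAt
    · refine le_of_le_of_eq ?_ hd.deriv.symm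
      linarith [(abs_le.1 (hb z hz)).2]
  have m2 : MonotoneOn (fun z => waveBound α β z + wave α β z) (Ici 0) := by
    refine monotoneOn_of_deriv_nonneg (convex_Ici 0)
      ((continuous_waveBound hα hβα).continuousOn.add (continuousOn_wave hα)) ?_ ?_ <;>
      intro z hz <;> rw [interior_Ici] at hz <;>
      have hd := (hasDerivAt_waveBound hβα hz).add (hasDerivAt_wave α β hz)
    · exact hd.differentiableAt.differentiableWithinAt
    · refine le_of_le_of_eq ?_ hd.deriv.symm
      linarith [(abs_le.1 (hb z hz)).1]
  have k1 := m1 hx (hx.trans hxy) hxy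
  have k2 := m2 hx (hx.trans hxy) hxy
  simp only at k1 k2
  exact abs_le.2 ⟨by linarith, by linarith⟩

theorem monotoneControlled_profile {α β δ : ℝ} (hα : 0 < α) (hβ : 0 < β) (hβα : β < α)
    (hδ : 0 < δ) : MonotoneControlled (profile α β δ) univ := by
  have hd : 0 < α - β := by linarith
  have hw : ∀ x, 0 ≤ x → 0 ≤ waveBound α β x := fun x hx => by
    unfold waveBound; positivity
  refine ⟨fun x => waveBound α β (max 0 (min x δ)), waveBound α β δ, fun x _ => ?_,
    fun x _ y _ hxy => ?_⟩
  · have h0 : 0 ≤ max 0 (min x δ) := le_max_left _ _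
    have h1 : max 0 (min x δ) ≤ δ := max_le hδ.le (min_le_right _ _)
    constructor
    · rw [abs_of_nonneg (hw _ h0)]
      unfold waveBound
      gcongr
    · rw [abs_of_nonneg (profile_nonneg _ _ _ _)]
      refine (profile_le hα hδ).trans ?_
      unfold waveBound
      have : 0 ≤ β / (α - β) * δ ^ (α - β) := by positivity
      linarith
  · rw [profile_eq_wave, profile_eq_wave]
    exact abs_wave_sub_le hα hβ hβα (le_max_left _ _) (by gcongr)

/-! ### Crests of the profile and divergence of the amplified oscillations -/

/-- The points at which the sine in `wave` is alternately `1` and `-1`. -/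
noncomputable def crest (β : ℝ) (k : ℕ) : ℝ := (Real.pi / 2 + k * Real.pi) ^ (-β⁻¹)

theorem crest_pos (β : ℝ) (k : ℕ) : 0 < crest β k := by
  have := Real.pi_pos
  unfold crest; positivity

theorem antitone_crest {β : ℝ} (hβ : 0 < β) : Antitone (crest β) := by
  intro j k hjk
  have := Real.pi_pos
  refine Real.rpow_le_rpow_of_nonpos (by positivity) ?_ (by simp [hβ.le])
  gcongr

theorem crest_rpow_neg {β : ℝ} (hβ : 0 < β) (k : ℕ) :
    crest β k ^ (-β) = Real.pi / 2 + k * Real.pi := by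
  have := Real.pi_pos
  rw [crest, ← Real.rpow_mul (by positivity), neg_mul_neg, inv_mul_cancel₀ hβ.ne', Real.rpow_one]

theorem tendsto_crest {β : ℝ} (hβ : 0 < β) : Tendsto (crest β) atTop (𝓝 0) := by
  have h1 : Tendsto (fun k : ℕ => Real.pi / 2 + (k : ℝ) * Real.pi) atTop atTop :=
    tendsto_atTop_add_const_left _ _
      (tendsto_natCast_atTop_atTop.atTop_mul_const Real.pi_pos)
  exact (tendsto_rpow_neg_atTop (inv_pos.2 hβ)).comp h1

theorem wave_crest_even {α β : ℝ} (hβ : 0 < β) (n : ℕ) :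
    wave α β (crest β (2 * n)) = 3 * crest β (2 * n) ^ α := by
  have : Real.sin (Real.pi / 2 + ((2 * n : ℕ) : ℝ) * Real.pi) = 1 := by
    have : Real.pi / 2 + ((2 * n : ℕ) : ℝ) * Real.pi = Real.pi / 2 + n * (2 * Real.pi) := by
      push_cast; ring
    rw [this, Real.sin_add_nat_mul_two_pi, Real.sin_pi_div_two]
  rw [wave, crest_rpow_neg hβ, this]
  ring

theorem wave_crest_odd {α β : ℝ} (hβ : 0 < β) (n : ℕ) :
    wave α β (crest β (2 * n + 1)) = crest β (2 * n + 1) ^ α := by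
  have : Real.sin (Real.pi / 2 + ((2 * n + 1 : ℕ) : ℝ) * Real.pi) = -1 := by
    have : Real.pi / 2 + ((2 * n + 1 : ℕ) : ℝ) * Real.pi =
        Real.pi / 2 + Real.pi + n * (2 * Real.pi) := by
      push_cast; ring
    rw [this, Real.sin_add_nat_mul_two_pi, Real.sin_add_pi, Real.sin_pi_div_two]
  rw [wave, crest_rpow_neg hβ, this]
  ring

/-- The left-hand power is `b ^ (-α / (3 * β))` with `b = π / 2 + 2 * n * π ≥ 1`, and the exponent
is at least `-1` because `α / 3 < β`. This compares the amplified oscillations with the harmonic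
series. -/
theorem crest_rpow_ge {α β : ℝ} (hα : 0 < α) (hβ : α / 3 < β) (n : ℕ) :
    1 / (8 * ((n : ℝ) + 1)) ≤ crest β (2 * n) ^ (α / 3) := by
  have hβ0 : 0 < β := by linarith
  have hpi := Real.pi_gt_three
  have hpi' := Real.pi_lt_four
  have hn : (0 : ℝ) ≤ n := n.cast_nonneg
  set b : ℝ := Real.pi / 2 + ((2 * n : ℕ) : ℝ) * Real.pi with hb
  have hb1 : 1 ≤ b := by rw [hb]; push_cast; nlinarith
  have hb2 : b ≤ 8 * (n + 1) := by rw [hb]; push_cast; nlinarith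
  have he : -1 ≤ -β⁻¹ * (α / 3) := by
    have : β⁻¹ * (α / 3) ≤ 1 := by
      rw [inv_mul_le_iff₀ hβ0]; linarith
    linarith
  rw [crest, ← hb, ← Real.rpow_mul (by linarith)]
  calc 1 / (8 * ((n : ℝ) + 1)) ≤ 1 / b := one_div_le_one_div_of_le (by linarith) hb2
    _ = b ^ (-1 : ℝ) := by rw [Real.rpow_neg_one, one_div]
    _ ≤ _ := Real.rpow_le_rpow_of_exponent_le hb1 he

theorem tendsto_sum_crest {α β : ℝ} (hα : 0 < α) (hβ : α / 3 < β) (N : ℕ) :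
    Tendsto (fun n => ∑ i ∈ Finset.range n, crest β (2 * (N + i)) ^ (α / 3)) atTop atTop := by
  have h1 := Real.tendsto_sum_range_one_div_nat_succ_atTop
  have h2 : Tendsto (fun n : ℕ => (1 / (8 * (N + 1) : ℝ)) *
      ∑ i ∈ Finset.range n, 1 / ((i : ℝ) + 1)) atTop atTop :=
    h1.const_mul_atTop (by positivity)
  refine tendsto_atTop_mono (fun n => ?_) h2
  rw [Finset.mul_sum]
  refine Finset.sum_le_sum fun i _ => le_trans ?_ (crest_rpow_ge hα hβ (N + i))
  rw [one_div_mul_one_div]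
  refine one_div_le_one_div_of_le (by positivity) ?_
  push_cast
  nlinarith [mul_nonneg (N.cast_nonneg (α := ℝ)) (i.cast_nonneg (α := ℝ))]

/-- Only every second increment is kept: those from an even-indexed crest to the next odd one
already have divergent sum. -/
theorem sum_edist_le_eVariationOn (f : ℝ → ℝ) {u : ℕ → ℝ} (hu : Antitone u) (n : ℕ) :
    ∑ i ∈ Finset.range n, edist (f (u (2 * i + 1))) (f (u (2 * i))) ≤ eVariationOn f univ := by
  have h1 : ∑ i ∈ Finset.range (2 * n), edist (f (u (i + 1))) (f (u i)) ≤ eVariationOn f univ := by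
    calc _ ≤ eVariationOn (f ∘ u) univ :=
          eVariationOn.sum_le (f := f ∘ u) monotone_id fun _ => mem_univ _
      _ = eVariationOn f (u '' univ) := eVariationOn.comp_eq_of_antitoneOn f u (hu.antitoneOn _)
      _ ≤ _ := eVariationOn.mono f (subset_univ _)
  refine le_trans ?_ h1
  induction n with
  | zero => simp
  | succ n ih =>
    have ih' := ih (le_trans (Finset.sum_le_sum_of_subset (by simp)) h1)
    rw [Finset.sum_range_succ, show 2 * (n + 1) = 2 * n + 1 + 1 by ring, Finset.sum_range_succ,
      Finset.sum_range_succ]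
    exact le_add_right (add_le_add ih' le_rfl)

/-! ### Approximate solutions: explicit form, existence, variation -/

theorem half_add_of_w₁ {ρ u : ℝ} (h : w₁ ρ u = 0) : ρ = w₂ ρ u / 2 := by
  unfold w₁ at h; unfold w₂; linarith

theorem continuous_w₁ : Continuous fun z : ℝ × ℝ => w₁ z.1 z.2 := by unfold w₁; fun_prop

theorem continuous_w₂ : Continuous fun z : ℝ × ℝ => w₂ z.1 z.2 := by unfold w₂; fun_prop

theorem lt_of_lt_half_div {c ξ t : ℝ} (hc : 0 < c) (h : t < ξ / (2 * c)) : 0 < ξ - 2 * c * t := by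
  rw [lt_div_iff₀ (by positivity)] at h; linarith

section Solution

variable {α β δ c ξ : ℝ} {ρ u : ℝ → ℝ → ℝ}

theorem IsInitialDatum.right {ρ₀ u₀ : ℝ → ℝ} (h : IsInitialDatum α β δ ξ ρ₀ u₀) {x : ℝ}
    (hx : ξ < x) : w₁ (ρ₀ x) (u₀ x) = 1 ∧
      w₂ (ρ₀ x) (u₀ x) = behind (profile α β δ ξ / 2) := by
  obtain ⟨-, ρL, uL, ρR, uR, h1, h2, h3, h4, h5⟩ := h
  rw [(h5 x hx).1, (h5 x hx).2, ← h2, ← half_add_of_w₁ h1]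
  exact h3.jump_eq h1 h4

theorem IsInitialDatum.density {ρ₀ u₀ : ℝ → ℝ} (h : IsInitialDatum α β δ ξ ρ₀ u₀) {x : ℝ}
    (hx : x < ξ) : ρ₀ x = profile α β δ x / 2 := by
  rw [half_add_of_w₁ (h.1 x hx).1, (h.1 x hx).2]

theorem IsApproxSolution.left (h₀ : IsInitialDatum α β δ ξ (ρ 0) (u 0))
    (h : IsApproxSolution c ξ (ξ / (2 * c)) ρ u) (hc : 0 < c) {t x : ℝ} (ht : 0 ≤ t)
    (htT : t < ξ / (2 * c)) (hx : x < ξ - c * t) :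
    w₁ (ρ t x) (u t x) = 0 ∧ w₂ (ρ t x) (u t x) = profile α β δ (x - c * t) := by
  have hct : 0 ≤ c * t := by positivity
  constructor
  · have := h.one_waves 0 t (x + c * t) le_rfl ht htT (by rw [mul_zero, sub_zero]; linarith)
    rw [sub_zero, add_sub_cancel_right] at this
    rw [this, (h₀.1 _ (by linarith)).1]
  · have := h.two_waves 0 t (x - c * t) le_rfl ht htT (Or.inl (by rw [sub_zero]; linarith))
    rw [sub_zero, sub_add_cancel] at this
    rw [this, (h₀.1 _ (by linarith)).2]

theorem IsApproxSolution.right_w₁ (h₀ : IsInitialDatum α β δ ξ (ρ 0) (u 0))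
    (h : IsApproxSolution c ξ (ξ / (2 * c)) ρ u) {t x : ℝ} (ht : 0 ≤ t)
    (htT : t < ξ / (2 * c)) (hx : ξ - c * t < x) : w₁ (ρ t x) (u t x) = 1 := by
  have := h.one_waves 0 t (x + c * t) le_rfl ht htT (by rw [mul_zero, sub_zero]; linarith)
  rw [sub_zero, add_sub_cancel_right] at this
  rw [this, (h₀.right (by linarith)).1]

/-- Approaching the shock at fixed time identifies the left state and the value of `w₁` on the
right; the shock is then a unit one, and `IsOneShock.jump_eq` gives the remaining invariant. -/
theorem IsApproxSolution.right_trace (hδ : 0 < δ) (h₀ : IsInitialDatum α β δ ξ (ρ 0) (u 0))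
    (h : IsApproxSolution c ξ (ξ / (2 * c)) ρ u) (hc : 0 < c) {t : ℝ} (ht : 0 ≤ t)
    (htT : t < ξ / (2 * c)) :
    Tendsto (fun z : ℝ × ℝ => w₂ (ρ z.1 z.2) (u z.1 z.2))
      (𝓝[rightRegion c ξ (ξ / (2 * c))] (t, ξ - c * t))
      (𝓝 (behind (profile α β δ (ξ - 2 * c * t) / 2))) := by
  obtain ⟨ρL, uL, ρR, uR, hL, hR, hS⟩ := h.shock t ht htT
  have hpos := lt_of_lt_half_div hc htT
  have curve : Tendsto (fun x : ℝ => (t, x)) (𝓝 (ξ - c * t)) (𝓝 (t, ξ - c * t)) :=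
    (continuous_const.prodMk continuous_id).tendsto' _ _ rfl
  have curveL : Tendsto (fun x : ℝ => (t, x)) (𝓝[<] (ξ - c * t))
      (𝓝[leftRegion c ξ (ξ / (2 * c))] (t, ξ - c * t)) :=
    tendsto_nhdsWithin_iff.2 ⟨curve.mono_left nhdsWithin_le_nhds,
      by filter_upwards [self_mem_nhdsWithin] with x hx using ⟨ht, htT, hx⟩⟩
  have curveR : Tendsto (fun x : ℝ => (t, x)) (𝓝[>] (ξ - c * t))
      (𝓝[rightRegion c ξ (ξ / (2 * c))] (t, ξ - c * t)) :=
    tendsto_nhdsWithin_iff.2 ⟨curve.mono_left nhdsWithin_le_nhds,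
      by filter_upwards [self_mem_nhdsWithin] with x hx using ⟨ht, htT, hx⟩⟩
  have l1 : w₁ ρL uL = 0 := by
    refine tendsto_nhds_unique (((continuous_w₁.tendsto _).comp hL).comp curveL) ?_
    refine tendsto_const_nhds.congr' ?_
    filter_upwards [self_mem_nhdsWithin] with x hx
    exact (h.left h₀ hc ht htT hx).1.symm
  have l2 : w₂ ρL uL = profile α β δ (ξ - 2 * c * t) := by
    refine tendsto_nhds_unique (((continuous_w₂.tendsto _).comp hL).comp curveL) ?_
    have hp : Tendsto (fun x => profile α β δ (x - c * t)) (𝓝[<] (ξ - c * t))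
        (𝓝 (profile α β δ (ξ - 2 * c * t))) := by
      have : Tendsto (fun x => x - c * t) (𝓝 (ξ - c * t)) (𝓝 (ξ - 2 * c * t)) :=
        (continuous_sub_right (c * t)).tendsto' _ _ (by ring)
      exact ((continuousAt_profile hδ hpos).tendsto.comp this).mono_left nhdsWithin_le_nhds
    refine hp.congr' ?_
    filter_upwards [self_mem_nhdsWithin] with x hx
    exact (h.left h₀ hc ht htT hx).2.symm
  have r1 : w₁ ρR uR = 1 := by
    refine tendsto_nhds_unique (((continuous_w₁.tendsto _).comp hR).comp curveR) ?_
    refine tendsto_const_nhds.congr' ?_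
    filter_upwards [self_mem_nhdsWithin] with x hx
    exact (h.right_w₁ h₀ ht htT hx).symm
  have e := (hS.jump_eq l1 (by rw [r1, l1]; norm_num)).2
  rw [half_add_of_w₁ l1, l2] at e
  rw [← e]
  exact (continuous_w₂.tendsto (ρR, uR)).comp hR

theorem IsApproxSolution.right_w₂ (hδ : 0 < δ) (hδξ : δ ≤ ξ)
    (h₀ : IsInitialDatum α β δ ξ (ρ 0) (u 0)) (h : IsApproxSolution c ξ (ξ / (2 * c)) ρ u)
    (hc : 0 < c) {t x : ℝ} (ht : 0 ≤ t) (htT : t < ξ / (2 * c)) (hx : ξ - c * t < x) :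
    w₂ (ρ t x) (u t x) = behind (profile α β δ (x - c * t) / 2) := by
  obtain ⟨y, rfl⟩ : ∃ y, x = y + c * t := ⟨x - c * t, by ring⟩
  rw [add_sub_cancel_right]
  rcases lt_or_ge ξ y with hy | hy
  · have := h.two_waves 0 t y le_rfl ht htT (Or.inr (by rw [mul_zero, sub_zero]; exact hy))
    rw [sub_zero] at this
    -- The profile is constant beyond `δ ≤ ξ`, so the formula also covers characteristics that start
    -- to the right of the shock.
    rw [this, (h₀.right hy).2, profile, profile, min_eq_right hδξ, min_eq_right (hδξ.trans hy.le)]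
  -- At time `s` the 2-characteristic through `(t, y + c * t)` leaves the shock. Constancy of `w₂`
  -- holds only strictly after `s`, so its value is the limit as `σ` decreases to `s`.
  · set s := (ξ - y) / (2 * c) with hs
    have hs0 : 0 ≤ s := div_nonneg (by linarith) (by positivity)
    have hsc : 2 * c * s = ξ - y := by rw [hs]; field_simp
    have hst : s < t := by
      have : 2 * c * s < 2 * c * t := by rw [hsc]; linarith
      exact lt_of_mul_lt_mul_left this (by positivity)
    have hT := h.right_trace hδ h₀ hc hs0 (hst.trans htT)
    rw [hsc, sub_sub_cancel] at hT
    have curve : Tendsto (fun σ : ℝ => (σ, y + c * σ)) (𝓝[>] s)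
        (𝓝[rightRegion c ξ (ξ / (2 * c))] (s, ξ - c * s)) := by
      refine tendsto_nhdsWithin_iff.2 ⟨?_, ?_⟩
      · have : Continuous fun σ : ℝ => (σ, y + c * σ) := by fun_prop
        exact (this.tendsto' s (s, ξ - c * s) (by ext <;> simp only; linarith)).mono_left
          nhdsWithin_le_nhds
      · filter_upwards [Ioo_mem_nhdsGT hst] with σ hσ
        have : c * s < c * σ := by gcongr; exact hσ.1
        exact ⟨hs0.trans hσ.1.le, hσ.2.trans htT, by simp only; linarith⟩
    refine tendsto_nhds_unique ?_ (hT.comp curve)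
    refine tendsto_const_nhds.congr' ?_
    filter_upwards [Ioo_mem_nhdsGT hst] with σ hσ
    have h1 : c * s < c * σ := by gcongr; exact hσ.1
    have := h.two_waves σ t (y + c * σ) (hs0.trans hσ.1.le) hσ.2.le htT (Or.inr (by linarith))
    rw [show y + c * σ + c * (t - σ) = y + c * t by ring] at this
    exact this

-- The candidate is the explicit form forced by the equations, with the right-hand formula used on
-- the shock line. Continuity of the profile away from `0` and of `jump` at positive densities
-- provides the traces.
open Classical in
theorem exists_isApproxSolution (hα : 0 < α) (hδ : 0 < δ) (hδξ : δ ≤ ξ) (hc : 0 < c) :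
    ∃ ρ u : ℝ → ℝ → ℝ, IsInitialDatum α β δ ξ (ρ 0) (u 0) ∧
      IsApproxSolution c ξ (ξ / (2 * c)) ρ u := by
  set P := profile α β δ with hP
  set H : ℝ → ℝ := fun y => P y / 2 + jump (P y / 2) with hH
  have hPpos : ∀ y, 0 < y → 0 < P y / 2 := fun y hy => half_pos (profile_pos hα hδ hy)
  have hHpos : ∀ y, 0 < y → 0 < H y := fun y hy =>
    add_pos (hPpos y hy) (jumpRel_jump (hPpos y hy)).2.1
  have hξ : 0 < ξ := hδ.trans_le hδξ
  refine ⟨fun t x => if x < ξ - c * t then P (x - c * t) / 2 else H (x - c * t),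
    fun t x => if x < ξ - c * t then P (x - c * t) / 2 else H (x - c * t) - 1, ?_, ?_⟩
  · refine ⟨fun x hx => ?_, P ξ / 2, P ξ / 2, H ξ, H ξ - 1, ?_, ?_, isOneShock_jump (hPpos ξ hξ),
      ?_, fun x hx => ?_⟩
    · simp only [mul_zero, sub_zero, if_pos hx, w₁, w₂]
      exact ⟨sub_self _, add_halves _⟩
    · simp [w₁]
    · simp [w₂, hP]
    · simp [w₁]
    · have e : P x = P ξ := by
        rw [hP, profile, profile, min_eq_right hδξ, min_eq_right (hδξ.trans hx.le)]
      simp only [mul_zero, sub_zero, if_neg hx.not_gt, hH, e, and_self]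
  · refine ⟨fun t x ht htT => ?_, fun s t y hs hst htT hy => ?_, fun s t y hs hst htT hy => ?_,
      fun t ht htT => ?_⟩
    · have hpos := lt_of_lt_half_div hc htT
      split_ifs with hx
      · exact div_nonneg (profile_nonneg _ _ _ _) zero_le_two
      · exact (hHpos _ (by linarith)).le
    · have e : y - c * (t - s) < ξ - c * t ↔ y < ξ - c * s := by
        constructor <;> intro <;> linarith
      simp only [e, w₁]
      split_ifs <;> ring
    · have hcs : 0 ≤ c * (t - s) := mul_nonneg hc.le (by linarith)
      have e : y + c * (t - s) - c * t = y - c * s := by ring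
      rcases hy with hy | hy
      · have hy' : y < ξ - c * s := by linarith
        simp only [if_pos hy, if_pos hy', e]
      · have hy' : ¬ (y + c * (t - s) < ξ - c * t) := by linarith
        simp only [if_neg hy', if_neg hy.not_gt, e]
    · have hpos := lt_of_lt_half_div hc htT
      have hcP : ContinuousAt (fun x => P x / 2) (ξ - 2 * c * t) :=
        (continuousAt_profile hδ hpos).div_const 2
      have hcH : ContinuousAt H (ξ - 2 * c * t) :=
        hcP.add (ContinuousAt.comp (g := jump) (continuousAt_jump (hPpos _ hpos)) hcP)
      have hz : Tendsto (fun z : ℝ × ℝ => z.2 - c * z.1) (𝓝 (t, ξ - c * t)) (𝓝 (ξ - 2 * c * t)) := by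
        have : Continuous fun z : ℝ × ℝ => z.2 - c * z.1 := by fun_prop
        exact this.tendsto' _ _ (by simp only; ring)
      refine ⟨_, _, _, _, ?_, ?_, isOneShock_jump (hPpos _ hpos)⟩
      · have := ((hcP.tendsto.comp hz).prodMk_nhds (hcP.tendsto.comp hz)).mono_left
          (nhdsWithin_le_nhds (s := leftRegion c ξ (ξ / (2 * c))))
        refine this.congr' ?_
        filter_upwards [self_mem_nhdsWithin] with z hz
        simp only [Function.comp, if_pos hz.2.2]
      · have := ((hcH.tendsto.comp hz).prodMk_nhds ((hcH.tendsto.comp hz).sub_const 1)).mono_left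
          (nhdsWithin_le_nhds (s := rightRegion c ξ (ξ / (2 * c))))
        refine this.congr' ?_
        filter_upwards [self_mem_nhdsWithin] with z hz
        simp only [Function.comp, if_neg hz.2.2.not_gt]

theorem IsApproxSolution.totalVariation_lt_top (hα : 0 < α) (hβ : 0 < β) (hβα : β < α)
    (hδ : 0 < δ) (hδξ : δ ≤ ξ) (h₀ : IsInitialDatum α β δ ξ (ρ 0) (u 0))
    (h : IsApproxSolution c ξ (ξ / (2 * c)) ρ u) (hc : 0 < c) {t : ℝ} (ht : 0 ≤ t)
    (htT : t < ξ / (2 * c)) : totalVariation (ρ t) (u t) < ⊤ := by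
  have hpos := lt_of_lt_half_div hc htT
  have hP := monotoneControlled_profile hα hβ hβα hδ
  have hP2 : MonotoneControlled (fun x => profile α β δ x / 2) univ := by
    refine hP.comp_lipschitz (G := fun x => x / 2) (r := 0) (K := 1) zero_le_one
      (fun x _ => by simp) fun x _ y _ => ?_
    rw [← sub_div, abs_div, abs_two]
    linarith [abs_nonneg (profile α β δ (y - 0) - profile α β δ (x - 0))]
  refine ENNReal.add_lt_top.2 ⟨?_, ?_⟩
  · refine (MonotoneControlled.glue (p := ξ - c * t)
      (monotoneControlled_of_eqOn_const (b := 0) fun x hx => (h.left h₀ hc ht htT hx).1)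
      (monotoneControlled_of_eqOn_const (b := 1)
        fun x hx => h.right_w₁ h₀ ht htT hx)).eVariationOn_lt_top
  · have hm : 0 < min (ξ - 2 * c * t) δ := lt_min hpos hδ
    -- Half of `min (ξ - 2 * c * t) δ ^ α` bounds from below the density ahead met by every 2-wave
    -- that has crossed by time `t`.
    have hm' : 0 < min (ξ - 2 * c * t) δ ^ α / 2 := by positivity
    have hge : ∀ x, ξ - c * t < x → min (ξ - 2 * c * t) δ ^ α / 2 ≤ profile α β δ (x - c * t) / 2 :=
      fun x hx => by
        have hx' : min (ξ - 2 * c * t) δ ≤ x - c * t := (min_le_left _ _).trans (by linarith)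
        have := profile_ge (β := β) hα hm.le (min_le_right _ _) hx'
        linarith
    refine (MonotoneControlled.glue (p := ξ - c * t)
      (hP.shift fun x hx => (h.left h₀ hc ht htT hx).2)
      (hP2.comp_lipschitz (G := behind) (K := 2 * (2 + 1 / (min (ξ - 2 * c * t) δ ^ α / 2)))
        (by positivity) (fun x hx => h.right_w₂ hδ hδξ h₀ hc ht htT hx)
        fun x hx y hy => behind_lipschitz hm' (hge x hx) (hge y hy))).eVariationOn_lt_top

theorem half_profile_lt {a₀ x : ℝ} (hα : 0 < α) (ha₀ : 0 < a₀) (hδ : 0 < δ)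
    (h : δ < (a₀ / 3) ^ α⁻¹) : profile α β δ x / 2 < a₀ := by
  have h1 : δ ^ α < a₀ / 3 := by
    have := Real.rpow_lt_rpow hδ.le h hα
    rwa [← Real.rpow_mul (by positivity), inv_mul_cancel₀ hα.ne', Real.rpow_one] at this
  have h2 := profile_le (α := α) (β := β) (x := x) hα hδ
  have h3 : 0 < δ ^ α := by positivity
  linarith

theorem IsApproxSolution.amplification {κ a₀ : ℝ} (hα : 0 < α)
    (hκ : ∀ a, 0 < a → a < a₀ → κ * a ^ (-(2 / 3) : ℝ) ≤ jumpSlope a (jump a))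
    (ha₀ : ∀ x, profile α β δ x / 2 < a₀) (hδ : 0 < δ) (hδξ : δ ≤ ξ)
    (h₀ : IsInitialDatum α β δ ξ (ρ 0) (u 0))
    (h : IsApproxSolution c ξ (ξ / (2 * c)) ρ u) (hc : 0 < c) {t y z : ℝ} (ht : 0 ≤ t)
    (htT : t < ξ / (2 * c)) (hy : y ∈ Ioo (ξ - 2 * c * t) ξ) (hz : z ∈ Ioo (ξ - 2 * c * t) ξ) :
    κ * (max (ρ 0 y) (ρ 0 z)) ^ (-(2 / 3) : ℝ) * |w₂ (ρ 0 y) (u 0 y) - w₂ (ρ 0 z) (u 0 z)| ≤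
      |w₂ (ρ t (y + c * t)) (u t (y + c * t)) - w₂ (ρ t (z + c * t)) (u t (z + c * t))| := by
  have hpos := lt_of_lt_half_div hc htT
  have hP : ∀ x, ξ - 2 * c * t < x → 0 < profile α β δ x / 2 := fun x hx =>
    half_pos (profile_pos hα hδ (hpos.trans hx))
  rw [h.right_w₂ hδ hδξ h₀ hc ht htT (by linarith [hy.1]),
    h.right_w₂ hδ hδξ h₀ hc ht htT (by linarith [hz.1]), add_sub_cancel_right,
    add_sub_cancel_right, (h₀.1 y hy.2).2, (h₀.1 z hz.2).2,
    h₀.density hy.2, h₀.density hz.2]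
  have := behind_amplification hκ (hP y hy.1) (ha₀ y) (hP z hz.1) (ha₀ z)
  rwa [mul_div_cancel₀ _ two_ne_zero, mul_div_cancel₀ _ two_ne_zero] at this

theorem IsApproxSolution.gradient_amplification {κ a₀ : ℝ} (hα : 0 < α)
    (hκ : ∀ a, 0 < a → a < a₀ → κ * a ^ (-(2 / 3) : ℝ) ≤ jumpSlope a (jump a))
    (ha₀ : ∀ x, profile α β δ x / 2 < a₀) (hδ : 0 < δ) (hδξ : δ ≤ ξ)
    (h₀ : IsInitialDatum α β δ ξ (ρ 0) (u 0))
    (h : IsApproxSolution c ξ (ξ / (2 * c)) ρ u) (hc : 0 < c) {t y : ℝ} (ht : 0 ≤ t)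
    (htT : t < ξ / (2 * c)) (hy : y ∈ Ioo (ξ - 2 * c * t) δ) :
    DifferentiableAt ℝ (fun x => w₂ (ρ t x) (u t x)) (y + c * t) ∧
      κ * (ρ 0 y) ^ (-(2 / 3) : ℝ) *
          |α * y ^ (α - 1) * (2 + Real.sin (y ^ (-β))) -
            β * y ^ (α - β - 1) * Real.cos (y ^ (-β))| ≤
        |deriv (fun x => w₂ (ρ t x) (u t x)) (y + c * t)| := by
  have hpos := lt_of_lt_half_div hc htT
  have hy0 : 0 < y := hpos.trans hy.1
  have ha : 0 < profile α β δ y / 2 := half_pos (profile_pos hα hδ hy0)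
  have hp : HasDerivAt (profile α β δ) _ y := (hasDerivAt_wave α β hy0).congr_of_eventuallyEq (by
    filter_upwards [Ioo_mem_nhds hy0 hy.2] with x hx using profile_of_mem hx.1.le hx.2.le)
  have hB : HasDerivAt (fun x => behind (profile α β δ x / 2)) _ y :=
    HasDerivAt.comp (h₂ := behind) y (hasDerivAt_behind ha) (hp.div_const 2)
  have hS : HasDerivAt (fun x => behind (profile α β δ (x - c * t) / 2)) _ (y + c * t) :=
    HasDerivAt.comp_sub_const (y + c * t) (c * t) (by rw [add_sub_cancel_right]; exact hB)
  have hw := hS.congr_of_eventuallyEq (f₁ := fun x => w₂ (ρ t x) (u t x)) (by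
    have : ξ - c * t < y + c * t := by linarith [hy.1]
    filter_upwards [Ioi_mem_nhds this] with x hx using h.right_w₂ hδ hδξ h₀ hc ht htT hx)
  refine ⟨hw.differentiableAt, ?_⟩
  rw [hw.deriv, h₀.density (hy.2.trans_le hδξ)]
  have h1 := (jumpRel_jump ha).jumpSlope_pos
  have h2 := hκ _ ha (ha₀ y)
  generalize α * y ^ (α - 1) * (2 + Real.sin (y ^ (-β))) -
    β * y ^ (α - β - 1) * Real.cos (y ^ (-β)) = d
  rw [show ∀ J : ℝ, 2 * (1 + J) * (d / 2) = (1 + J) * d by intro J; ring, abs_mul,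
    abs_of_pos (by linarith : 0 < 1 + jumpSlope (profile α β δ y / 2) (jump (profile α β δ y / 2)))]
  exact mul_le_mul_of_nonneg_right (by linarith) (abs_nonneg d)

theorem IsApproxSolution.tendsto_totalVariation {κ a₀ : ℝ} (hκ0 : 0 < κ) (hα : 0 < α)
    (hβ : α / 3 < β)
    (hκ : ∀ a, 0 < a → a < a₀ → κ * a ^ (-(2 / 3) : ℝ) ≤ jumpSlope a (jump a))
    (ha₀ : ∀ x, profile α β δ x / 2 < a₀) (hδ : 0 < δ) (hδξ : δ ≤ ξ)
    (h₀ : IsInitialDatum α β δ ξ (ρ 0) (u 0))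
    (h : IsApproxSolution c ξ (ξ / (2 * c)) ρ u) (hc : 0 < c) :
    Tendsto (fun t => totalVariation (ρ t) (u t)) (𝓝[<] (ξ / (2 * c))) (𝓝 ⊤) := by
  have hβ0 : 0 < β := by linarith
  have hξ : 0 < ξ := hδ.trans_le hδξ
  have hT : 0 < ξ / (2 * c) := by positivity
  -- At an even crest `x` the density is `3 / 2 * x ^ α`, and `w₂` drops by at least `2 * x ^ α` on
  -- the way to the next crest.
  set C : ℝ := κ * (3 / 2) ^ (-(2 / 3) : ℝ) * 2 with hC
  have hC0 : 0 < C := by positivity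
  -- Crests are counted from index `2 * N`, which keeps their parity and places them all below `δ`.
  obtain ⟨N, hN⟩ := eventually_atTop.1 ((tendsto_crest hβ0).eventually_lt_const hδ)
  have hlt : ∀ k, crest β (2 * N + k) < δ := fun k => hN _ (by omega)
  rw [ENNReal.tendsto_nhds_top_iff_nat]
  intro M
  obtain ⟨n, hn⟩ := (((tendsto_sum_crest hα hβ N).const_mul_atTop hC0).eventually_gt_atTop
    (M : ℝ)).exists
  have hlim : Tendsto (fun t => ξ - 2 * c * t) (𝓝[<] (ξ / (2 * c))) (𝓝 0) := by
    have : Continuous fun t => ξ - 2 * c * t := by fun_prop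
    exact (this.tendsto' _ _ (by field_simp; ring)).mono_left nhdsWithin_le_nhds
  -- For `t` this close to the final time, all the crests used in the partial sum have crossed the
  -- shock.
  filter_upwards [hlim.eventually_lt_const (crest_pos β (2 * N + 2 * n)), Ioo_mem_nhdsLT hT]
    with t ht1 ht
  have hmem : ∀ k, k ≤ 2 * n → crest β (2 * N + k) ∈ Ioo (ξ - 2 * c * t) ξ := fun k hk =>
    ⟨ht1.trans_le (antitone_crest hβ0 (by omega)), (hlt k).trans_le hδξ⟩
  have key : ∀ i ∈ Finset.range n, ENNReal.ofReal (C * crest β (2 * (N + i)) ^ (α / 3)) ≤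
      edist (w₂ (ρ t (crest β (2 * N + (2 * i + 1)) + c * t))
          (u t (crest β (2 * N + (2 * i + 1)) + c * t)))
        (w₂ (ρ t (crest β (2 * N + 2 * i) + c * t)) (u t (crest β (2 * N + 2 * i) + c * t))) := by
    intro i hi
    rw [Finset.mem_range] at hi
    rw [edist_dist, Real.dist_eq]
    have hy := hmem (2 * i + 1) (by omega)
    have hz := hmem (2 * i) (by omega)
    refine ENNReal.ofReal_le_ofReal
      (le_trans ?_ (h.amplification hα hκ ha₀ hδ hδξ h₀ hc ht.1.le ht.2 hy hz))
    rw [(h₀.1 _ hy.2).2, (h₀.1 _ hz.2).2, h₀.density hy.2, h₀.density hz.2,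
      profile_of_mem (crest_pos _ _).le (hlt _).le, profile_of_mem (crest_pos _ _).le (hlt _).le,
      show 2 * N + (2 * i + 1) = 2 * (N + i) + 1 by ring, show 2 * N + 2 * i = 2 * (N + i) by ring,
      wave_crest_odd hβ0, wave_crest_even hβ0]
    have hle : crest β (2 * (N + i) + 1) ^ α ≤ crest β (2 * (N + i)) ^ α :=
      Real.rpow_le_rpow (crest_pos _ _).le (antitone_crest hβ0 (Nat.le_succ _)) hα.le
    have hp := crest_pos β (2 * (N + i))
    generalize crest β (2 * (N + i)) = x at *
    generalize crest β (2 * (N + i) + 1) ^ α = r at *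
    have hxα : 0 < x ^ α := by positivity
    rw [max_eq_right (by linarith), abs_sub_comm, abs_of_nonneg (by linarith),
      show 3 * x ^ α / 2 = 3 / 2 * x ^ α by ring, Real.mul_rpow (by norm_num) hxα.le,
      ← Real.rpow_mul hp.le]
    -- Amplification `(x ^ α) ^ (-2/3)` times oscillation `x ^ α` is the general term of the
    -- divergent series.
    have e : x ^ (α / 3) = x ^ (α * -(2 / 3)) * x ^ α := by
      rw [← Real.rpow_add hp]; congr 1; ring
    rw [e, hC]
    have : 2 * x ^ α ≤ 3 * x ^ α - r := by linarith
    calc _ = κ * ((3 / 2) ^ (-(2 / 3) : ℝ) * x ^ (α * -(2 / 3))) * (2 * x ^ α) := by ring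
      _ ≤ _ := by gcongr
  have hanti : Antitone fun k => crest β (2 * N + k) + c * t := fun j k hjk => by
    have := antitone_crest hβ0 (show 2 * N + j ≤ 2 * N + k by omega)
    simpa using this
  calc (M : ENNReal) = ENNReal.ofReal M := (ENNReal.ofReal_natCast M).symm
    _ < ENNReal.ofReal (C * ∑ i ∈ Finset.range n, crest β (2 * (N + i)) ^ (α / 3)) :=
        (ENNReal.ofReal_lt_ofReal_iff_of_nonneg M.cast_nonneg).2 hn
    _ = ∑ i ∈ Finset.range n, ENNReal.ofReal (C * crest β (2 * (N + i)) ^ (α / 3)) := by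
        rw [Finset.mul_sum, ENNReal.ofReal_sum_of_nonneg]
        intro i _
        have := crest_pos β (2 * (N + i))
        positivity
    _ ≤ _ := Finset.sum_le_sum key
    _ ≤ eVariationOn (fun x => w₂ (ρ t x) (u t x)) univ := sum_edist_le_eVariationOn _ hanti n
    _ ≤ _ := le_add_left le_rfl

end Solution

end PSystem

theorem mainTheorem2 (α β κ : ℝ) (hα : 0 < α / 3) (hβ : α / 3 < β) (hβα : β < α) (hα1 : α < 1)
    (hκ : κ < (3 : ℝ) ^ (-(2 / 3) : ℝ)) :
    ∃ δ₀ : ℝ, 0 < δ₀ ∧ ∀ δ c ξ : ℝ, 0 < δ → δ < δ₀ → 0 < c → δ ≤ ξ →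
      (∃ ρ u : ℝ → ℝ → ℝ, PSystem.IsInitialDatum α β δ ξ (ρ 0) (u 0) ∧
        PSystem.IsApproxSolution c ξ (ξ / (2 * c)) ρ u) ∧
      ∀ ρ u : ℝ → ℝ → ℝ, PSystem.IsInitialDatum α β δ ξ (ρ 0) (u 0) →
        PSystem.IsApproxSolution c ξ (ξ / (2 * c)) ρ u →
        -- the 1-shock keeps unit strength
        (∀ t x, 0 ≤ t → t < ξ / (2 * c) →
          (x < ξ - c * t → PSystem.w₁ (ρ t x) (u t x) = 0) ∧
          (ξ - c * t < x → PSystem.w₁ (ρ t x) (u t x) = 1)) ∧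
        -- amplification of the strength of the 2-wave between two points
        (∀ t y z, 0 ≤ t → t < ξ / (2 * c) →
          y ∈ Ioo (ξ - 2 * c * t) ξ → z ∈ Ioo (ξ - 2 * c * t) ξ →
          κ * (max (ρ 0 y) (ρ 0 z)) ^ (-(2 / 3) : ℝ) *
              |PSystem.w₂ (ρ 0 y) (u 0 y) - PSystem.w₂ (ρ 0 z) (u 0 z)| ≤
            |PSystem.w₂ (ρ t (y + c * t)) (u t (y + c * t)) -
              PSystem.w₂ (ρ t (z + c * t)) (u t (z + c * t))|) ∧
        -- amplification of the gradient
        (∀ t y, 0 ≤ t → t < ξ / (2 * c) → y ∈ Ioo (ξ - 2 * c * t) δ →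
          DifferentiableAt ℝ (fun x => PSystem.w₂ (ρ t x) (u t x)) (y + c * t) ∧
          κ * (ρ 0 y) ^ (-(2 / 3) : ℝ) *
              |α * y ^ (α - 1) * (2 + Real.sin (y ^ (-β))) -
                β * y ^ (α - β - 1) * Real.cos (y ^ (-β))| ≤
            |deriv (fun x => PSystem.w₂ (ρ t x) (u t x)) (y + c * t)|) ∧
        -- finite total variation at the initial time and before the final time, then blow up
        (∀ t, 0 ≤ t → t < ξ / (2 * c) → PSystem.totalVariation (ρ t) (u t) < ⊤) ∧
        Tendsto (fun t => PSystem.totalVariation (ρ t) (u t)) (𝓝[<] (ξ / (2 * c))) (𝓝 ⊤) := by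
  have hα0 : 0 < α := by linarith
  have hβ0 : 0 < β := hα.trans hβ
  -- The given `κ` may be negative or zero; the blow-up needs a positive constant still below `3 ^
  -- (-2/3)`.
  set κ' : ℝ := max κ (3 ^ (-(2 / 3) : ℝ) / 2) with hκ'
  have h3 : (0 : ℝ) < 3 ^ (-(2 / 3) : ℝ) := by positivity
  have hκ'0 : 0 < κ' := (half_pos h3).trans_le (le_max_right _ _)
  obtain ⟨a₀, ha₀, hslope'⟩ := PSystem.exists_jumpSlope_ge (κ := κ') (max_lt hκ (half_lt_self h3))
  have hslope : ∀ a, 0 < a → a < a₀ →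
      κ * a ^ (-(2 / 3) : ℝ) ≤ PSystem.jumpSlope a (PSystem.jump a) := fun a ha h =>
    (mul_le_mul_of_nonneg_right (le_max_left _ _) (by positivity)).trans (hslope' a ha h)
  -- The profile is at most `3 * δ ^ α`, so this choice keeps the density ahead of the shock below
  -- `a₀`.
  refine ⟨(a₀ / 3) ^ α⁻¹, by positivity, fun δ c ξ hδ hδ₀ hc hδξ =>
    ⟨PSystem.exists_isApproxSolution hα0 hδ hδξ hc, fun ρ u h₀ h => ?_⟩⟩
  have hsmall : ∀ x, PSystem.profile α β δ x / 2 < a₀ := fun x =>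
    PSystem.half_profile_lt hα0 ha₀ hδ hδ₀
  exact ⟨fun t x ht htT => ⟨fun hx => (h.left h₀ hc ht htT hx).1, h.right_w₁ h₀ ht htT⟩,
    fun t y z ht htT => h.amplification hα0 hslope hsmall hδ hδξ h₀ hc ht htT,
    fun t y ht htT => h.gradient_amplification hα0 hslope hsmall hδ hδξ h₀ hc ht htT,
    fun t ht htT => h.totalVariation_lt_top hα0 hβ0 hβα hδ hδξ h₀ hc ht htT,
    h.tendsto_totalVariation hκ'0 hα0 hβ hslope' hsmall hδ hδξ h₀ hc⟩
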